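/- **Theorem 2.7.** There is an absolute constant $C>0$ such that for all real $\kappa\ge 1$ and $0<\varepsilon\le\frac12$ there is a number $k$ of iterations, depending only on $\kappa$ and $\varepsilon$, with the following property. Let $M\in\mathbb{C}^{n\times n}$ be a (Hermitian) positive definite matrix whose Euclidean condition number satisfies $\kappa(M)=\Vert M\Vert\,\Vert M^{-1}\Vert\le\kappa$, let $s_1,\dots,s_r$ be distinct indices in $\{1,\dots,n\}$, and let $D=\big((M^{-1})_{s_i s_j}\big)_{i,j=1}^{r}$ be the corresponding $r\times r$ block on the diagonal of $M^{-1}$. Then $k$ iterations of the block Lanczos algorithm in exact arithmetic, started with the block $B=(e_{s_1},\dots,e_{s_r})$ and accessing $M$ only through matrix–vector products, use at most $$C\, r\,\sqrt{\kappa}\,\log(1/\varepsilon)$$ matrix–vector products with $M$ and return a matrix $\widetilde D\in\mathbb{C}^{r\times r}$ with relative error at most $\varepsilon$: $$\Vert \widetilde D-D\Vert\le\varepsilon\,\Vert D\Vert .$$ Here $\Vert\cdot\Vert$ is the operator norm. Block Lanczos with $k$ iterations computes, one block at a time, an orthonormal basis $Q$ of the block Krylov subspace $\mathrm{span}\{M^j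 e_{s_i} : 0\le j<k,\ 1\le i\le r\}$ and the products $MQ$, where linearly dependent vectors are dropped, and returns $\widetilde D=(Q^*B)^*\,(Q^*MQ)^{-1}\,(Q^*B)$. In particular, with $\kappa=\kappa(M)$ for $n\ge1$, the number of products is $O\big(r\sqrt{\kappa(M)}\log(1/\varepsilon)\big)$. -/

import Mathlib

open scoped ComplexOrder Matrix.Norms.L2Operator

/-- Deterministic adaptive algorithms whose only access to an unknown complex `n × n` matrix `M`
is through matrix–vector products `v ↦ M v`.  Such an algorithm either stops with a result, or
names a vector `v` and continues in a way that depends on the answer `M v`. -/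
inductive MatVecAlgorithm (n : ℕ) (α : Type) : Type
  | done (a : α) : MatVecAlgorithm n α
  | product (v : EuclideanSpace ℂ (Fin n))
      (next : EuclideanSpace ℂ (Fin n) → MatVecAlgorithm n α) : MatVecAlgorithm n α

namespace MatVecAlgorithm

variable {n : ℕ} {α β : Type}

/-- Sequential composition. -/
def bind : MatVecAlgorithm n α → (α → MatVecAlgorithm n β) → MatVecAlgorithm n β
  | done a, f => f a
  | product v next, f => product v fun w => (next w).bind f

/-- The result of the algorithm when the unknown matrix is `M`. -/
noncomputable def result (M : Matrix (Fin n) (Fin n) ℂ) : MatVecAlgorithm n α → α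
  | done a => a
  | product v next => (next (Matrix.toEuclideanLin M v)).result M

/-- The number of matrix–vector products with `M` that the algorithm performs
when the unknown matrix is `M`. -/
noncomputable def numProducts (M : Matrix (Fin n) (Fin n) ℂ) : MatVecAlgorithm n α → ℕ
  | done _ => 0
  | product v next => (next (Matrix.toEuclideanLin M v)).numProducts M + 1

/-- Multiply each vector of a list by `M`, one product per vector; the result is the list of the
pairs `(q, M q)`. -/
def multiplyAll : List (EuclideanSpace ℂ (Fin n)) →
    MatVecAlgorithm n (List (EuclideanSpace ℂ (Fin n) × EuclideanSpace ℂ (Fin n)))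
  | [] => done []
  | q :: Q => product q fun w => (multiplyAll Q).bind fun P => done ((q, w) :: P)

end MatVecAlgorithm

namespace BlockLanczos

variable {n : ℕ}

open Classical in
/-- Gram–Schmidt: given a list `Q` of orthonormal vectors and a list `W`, the list of new
orthonormal vectors, orthogonal to `Q`, which together with `Q` span the same space as `Q` and `W`.
Vectors that depend linearly on the earlier ones are dropped (deflation). -/
noncomputable def orthonormalize (Q : List (EuclideanSpace ℂ (Fin n))) :
    List (EuclideanSpace ℂ (Fin n)) → List (EuclideanSpace ℂ (Fin n))
  | [] => []
  | w :: W =>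
    let u := w - (Q.map fun q => inner ℂ q w • q).sum
    if u = 0 then orthonormalize Q W
    else ((‖u‖⁻¹ : ℝ) : ℂ) • u ::
      orthonormalize (Q ++ [((‖u‖⁻¹ : ℝ) : ℂ) • u]) W

/-- `k` further iterations of block Lanczos, with full orthogonalization (in exact arithmetic it
yields the same blocks as the three-term recurrence, for Hermitian `M`).  The list `P` holds the
pairs `(q, M q)` for the orthonormal vectors `q` found so far, and `W` is the block to be
orthonormalized next.  One iteration orthonormalizes `W` against the vectors found so far,
multiplies every new vector by `M`, and passes these products on as the next block. -/
noncomputable def iterate : ℕ →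
    List (EuclideanSpace ℂ (Fin n) × EuclideanSpace ℂ (Fin n)) → List (EuclideanSpace ℂ (Fin n)) →
    MatVecAlgorithm n (List (EuclideanSpace ℂ (Fin n) × EuclideanSpace ℂ (Fin n)))
  | 0, P, _ => .done P
  | k + 1, P, W =>
    (MatVecAlgorithm.multiplyAll (orthonormalize (P.map Prod.fst) W)).bind fun N =>
      iterate k (P ++ N) (N.map Prod.snd)

/-- With `Q` the matrix whose columns are the orthonormal vectors `q`, and `T = Qᴴ M Q`, the
estimate `(Qᴴ B)ᴴ T⁻¹ (Qᴴ B)` of the quadratic form `Bᴴ M⁻¹ B`.  Only the pairs `(q, M q)` are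
used. -/
noncomputable def estimate {r : ℕ} (B : Fin r → EuclideanSpace ℂ (Fin n))
    (P : List (EuclideanSpace ℂ (Fin n) × EuclideanSpace ℂ (Fin n))) :
    Matrix (Fin r) (Fin r) ℂ :=
  let T : Matrix (Fin P.length) (Fin P.length) ℂ :=
    Matrix.of fun a b => inner ℂ (P.get a).1 (P.get b).2
  let QB : Matrix (Fin P.length) (Fin r) ℂ := Matrix.of fun a i => inner ℂ (P.get a).1 (B i)
  QB.conjTranspose * T⁻¹ * QB

end BlockLanczos

/-- The block Lanczos algorithm with `k` iterations and the starting block with columns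
`B 0, …, B (r - 1)`.  It builds an orthonormal basis of the block Krylov subspace
`span {M ^ j (B i) | j < k, i < r}` and returns the resulting estimate of `Bᴴ M⁻¹ B`. -/
noncomputable def blockLanczos {n r : ℕ} (B : Fin r → EuclideanSpace ℂ (Fin n)) (k : ℕ) :
    MatVecAlgorithm n (Matrix (Fin r) (Fin r) ℂ) :=
  (BlockLanczos.iterate k [] (List.ofFn B)).bind fun P => .done (BlockLanczos.estimate B P)

/-- The Euclidean condition number `‖M‖ ‖M⁻¹‖` of an invertible matrix, for the operator norm. -/
noncomputable def conditionNumber {n : ℕ} (M : Matrix (Fin n) (Fin n) ℂ) : ℝ :=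
  ‖M‖ * ‖M⁻¹‖

/-! The returned matrix is the Galerkin approximation of `Sᴴ * M⁻¹ * S` on the range of `Q`, for the
starting block `S`. Completing the square (`Matrix.PosDef.galerkin_error_add`) shows that its error
is nonnegative and, in the Loewner order, at most the energy of `M⁻¹ * S - Q * V` for every `V`. The
Krylov space contains the columns of `q(M) * S` whenever `deg q < k`. If `|1 - x q(x)| ≤ δ` on the
spectrum, this competitor has energy at most `δ ^ 2 • (Sᴴ * M⁻¹ * S)`
(`Matrix.PosDef.energy_aeval_le`). That bound is a multiple of the target itself, so the error is
relative with no factor of `κ` lost. Chebyshev polynomials give `δ = 2 exp (-k / √(b / a))` on `[a,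
b]`, so `k` of order `√κ log (1 / ε)` suffices. Blocks never grow, so at most `k * r` products are
used. -/

/-! ### Chebyshev approximation of the inverse on an interval -/

section Chebyshev

open Polynomial

/-- The scaled Chebyshev polynomial, normalized to `1` at the origin. -/
theorem exists_polynomial_eval_zero_eq_one_abs_le {a b : ℝ} (ha : 0 < a) (hab : a < b) (k : ℕ) :
    ∃ p : ℝ[X], p.natDegree ≤ k ∧ p.eval 0 = 1 ∧
      ∀ x ∈ Set.Icc a b, |p.eval x| ≤ 2 * Real.exp (-(k / √(b / a))) := by
  set s := √(b / a) with hs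
  have hs2 : s ^ 2 = b / a := Real.sq_sqrt (div_pos (ha.trans hab) ha).le
  have hs1 : 1 < s := by
    rw [hs, Real.lt_sqrt zero_le_one, one_pow, one_lt_div ha]; exact hab
  have hb : b = s ^ 2 * a := by rw [hs2]; field_simp
  -- Chosen so that `cosh t = (b + a) / (b - a)`, the image of `0` under the affine map of `[a, b]`
  -- onto `[-1, 1]`; there `T_k` takes the value `cosh (k * t)`.
  set t := Real.log ((s + 1) / (s - 1)) with ht
  have hz : 0 < (s + 1) / (s - 1) := div_pos (by linarith) (by linarith)
  have hs3 : s - 1 ≠ 0 := by linarith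
  have hs4 : s + 1 ≠ 0 := by linarith
  have hcosh : Real.cosh t = (b + a) / (b - a) := by
    rw [ht, Real.cosh_log hz]
    have : s ^ 2 - 1 ≠ 0 := by nlinarith
    rw [hb, show s ^ 2 * a - a = (s ^ 2 - 1) * a by ring]
    field_simp
    ring
  -- From `log z ≥ 1 - 1 / z`: `t ≥ 2 / (s + 1) ≥ 1 / s`, since `s > 1`.
  have htle : 1 / s ≤ t := by
    have h := Real.one_sub_inv_le_log_of_pos hz
    refine le_trans ?_ h
    rw [inv_div, one_sub_div hs4, div_le_div_iff₀ (by linarith) (by linarith)]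
    linarith
  have hlow : Real.exp (k / s) / 2 ≤ Real.cosh (k * t) := by
    rw [Real.cosh_eq]
    have h1 : Real.exp (k / s) ≤ Real.exp (k * t) := by
      apply Real.exp_le_exp.2
      calc (k : ℝ) / s = k * (1 / s) := by ring
        _ ≤ k * t := by gcongr
    have := Real.exp_pos (-(k * t))
    linarith
  have hpos : 0 < Real.cosh (k * t) := Real.cosh_pos _
  refine ⟨C (Real.cosh (k * t))⁻¹ *
    (Chebyshev.T ℝ k).comp (C ((b + a) / (b - a)) - C (2 / (b - a)) * X), ?_, ?_, ?_⟩
  · refine (natDegree_C_mul_le _ _).trans (natDegree_comp_le.trans ?_)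
    have h1 : (Chebyshev.T ℝ (k : ℤ)).natDegree ≤ k := by
      simp
    have h2 : (C ((b + a) / (b - a)) - C (2 / (b - a)) * X : ℝ[X]).natDegree ≤ 1 := by
      compute_degree
    calc _ ≤ k * 1 := Nat.mul_le_mul h1 h2
      _ = k := mul_one k
  · have h : (Chebyshev.T ℝ (k : ℤ)).eval (Real.cosh t) = Real.cosh (k * t) := by
      simp
    simp [eval_comp, ← hcosh, h, hpos.ne']
  · intro x hx
    have hy : |(b + a) / (b - a) - 2 / (b - a) * x| ≤ 1 := by
      rw [div_mul_eq_mul_div, ← sub_div, abs_div, abs_of_pos (by linarith : 0 < b - a),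
        div_le_one (by linarith), abs_le]
      constructor <;> linarith [hx.1, hx.2]
    have h := Chebyshev.abs_eval_T_real_le_one (k : ℤ) hy
    simp only [eval_mul, eval_C, eval_comp, eval_sub, eval_X]
    rw [abs_mul, abs_of_pos (inv_pos.2 hpos), Real.exp_neg]
    calc _ ≤ (Real.cosh (k * t))⁻¹ * 1 := by gcongr
      _ ≤ (Real.exp (k / s) / 2)⁻¹ * 1 := by gcongr
      _ = _ := by rw [inv_div]; ring

/-- Since `p(0) = 1`, the polynomial `1 - p` is divisible by `X`; the quotient is `q`, of degree one
less. -/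
theorem exists_polynomial_abs_one_sub_mul_le {a b : ℝ} (ha : 0 < a) (hab : a < b) {k : ℕ}
    (hk : 0 < k) :
    ∃ q : ℝ[X], q.natDegree < k ∧
      ∀ x ∈ Set.Icc a b, |1 - x * q.eval x| ≤ 2 * Real.exp (-(k / √(b / a))) := by
  obtain ⟨p, hp, hp0, hpb⟩ := exists_polynomial_eval_zero_eq_one_abs_le ha hab k
  refine ⟨-p.divX, ?_, fun x hx => ?_⟩
  · rw [natDegree_neg, natDegree_divX_eq_natDegree_tsub_one]
    omega
  · have h := congrArg (eval x) (X_mul_divX_add p)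
    rw [coeff_zero_eq_eval_zero, hp0] at h
    simp only [eval_add, eval_mul, eval_X, eval_C] at h
    convert hpb x hx using 2
    rw [eval_neg, ← h]
    ring

end Chebyshev

/-! ### Galerkin error and energy bounds in the Loewner order -/

section Galerkin

open scoped MatrixOrder
open Matrix Polynomial

namespace Matrix

variable {m n r : Type*} [Fintype m] [Fintype n] [DecidableEq m] [DecidableEq n]

/-- Completing the square. It is used for both `M` and the compression `Qᴴ * M * Q`; the cross terms
agree, which yields the error identity. -/
theorem PosDef.conjTranspose_inv_mul_sub_mul_mul {A : Matrix n n ℂ} (hA : A.PosDef)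
    (S V : Matrix n r ℂ) :
    (A⁻¹ * S - V)ᴴ * A * (A⁻¹ * S - V) = Sᴴ * A⁻¹ * S - Sᴴ * V - Vᴴ * S + Vᴴ * A * V := by
  have hu : IsUnit A.det := (isUnit_iff_isUnit_det A).1 hA.isUnit
  have hH : A⁻¹ᴴ = A⁻¹ := hA.isHermitian.inv
  rw [conjTranspose_sub, conjTranspose_mul, hH, Matrix.sub_mul, Matrix.sub_mul, Matrix.mul_sub,
    Matrix.mul_sub,
    nonsing_inv_mul_cancel_right _ _ hu, Matrix.mul_assoc Vᴴ A (A⁻¹ * S),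
    mul_nonsing_inv_cancel_left _ _ hu, ← Matrix.mul_assoc]
  abel

/-- The error of the Galerkin approximation of `Sᴴ * M⁻¹ * S` on the range of `Q`, compared with
the energy of an arbitrary approximation `Q * V` of `M⁻¹ * S`. -/
theorem PosDef.galerkin_error_add {M : Matrix n n ℂ} (hM : M.PosDef) {Q : Matrix n m ℂ}
    (hT : (Qᴴ * M * Q).PosDef) (S : Matrix n r ℂ) (V : Matrix m r ℂ) :
    (Sᴴ * M⁻¹ * S - (Qᴴ * S)ᴴ * (Qᴴ * M * Q)⁻¹ * (Qᴴ * S)) +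
      ((Qᴴ * M * Q)⁻¹ * (Qᴴ * S) - V)ᴴ * (Qᴴ * M * Q) * ((Qᴴ * M * Q)⁻¹ * (Qᴴ * S) - V) =
    (M⁻¹ * S - Q * V)ᴴ * M * (M⁻¹ * S - Q * V) := by
  rw [hT.conjTranspose_inv_mul_sub_mul_mul, hM.conjTranspose_inv_mul_sub_mul_mul]
  simp only [conjTranspose_mul, conjTranspose_conjTranspose, Matrix.mul_assoc]
  abel

theorem PosDef.galerkin_error_nonneg [Finite r] {M : Matrix n n ℂ} (hM : M.PosDef) {Q : Matrix n m ℂ}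
    (hT : (Qᴴ * M * Q).PosDef) (S : Matrix n r ℂ) :
    0 ≤ Sᴴ * M⁻¹ * S - (Qᴴ * S)ᴴ * (Qᴴ * M * Q)⁻¹ * (Qᴴ * S) := by
  have h := hM.galerkin_error_add hT S ((Qᴴ * M * Q)⁻¹ * (Qᴴ * S))
  rw [sub_self, Matrix.mul_zero, add_zero] at h
  rw [h]
  exact (hM.posSemidef.conjTranspose_mul_mul_same _).nonneg

theorem PosDef.galerkin_error_le [Finite r] {M : Matrix n n ℂ} (hM : M.PosDef) {Q : Matrix n m ℂ}
    (hT : (Qᴴ * M * Q).PosDef) (S : Matrix n r ℂ) (V : Matrix m r ℂ) :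
    Sᴴ * M⁻¹ * S - (Qᴴ * S)ᴴ * (Qᴴ * M * Q)⁻¹ * (Qᴴ * S) ≤
      (M⁻¹ * S - Q * V)ᴴ * M * (M⁻¹ * S - Q * V) := by
  rw [← hM.galerkin_error_add hT S V]
  exact le_add_of_nonneg_right (hT.posSemidef.conjTranspose_mul_mul_same _).nonneg

/-- Spectral values are bounded by the norm, for `M` and for `M⁻¹`. -/
theorem PosDef.spectrum_subset_Icc {M : Matrix n n ℂ} (hM : M.PosDef) :
    spectrum ℝ M ⊆ Set.Icc (‖M⁻¹‖⁻¹) ‖M‖ := by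
  intro x hx
  rcases isEmpty_or_nonempty n with hn | hn
  · exact absurd hx (by simp [spectrum.of_subsingleton])
  have hx0 : 0 ≤ x := spectrum_nonneg_of_nonneg hM.posSemidef.nonneg hx
  have hxne : x ≠ 0 := by
    rintro rfl
    exact spectrum.zero_notMem ℝ hM.isUnit hx
  have hinv : x⁻¹ ∈ spectrum ℝ M⁻¹ := by
    obtain ⟨u, rfl⟩ := hM.isUnit
    rw [← Matrix.coe_units_inv]
    exact spectrum.inv₀_mem_iff.2 (by simpa using hx)
  have h1 := spectrum.norm_le_norm_of_mem hx
  have h2 := spectrum.norm_le_norm_of_mem hinv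
  rw [Real.norm_of_nonneg hx0] at h1
  rw [Real.norm_of_nonneg (inv_nonneg.2 hx0)] at h2
  exact ⟨inv_le_of_inv_le₀ (hx0.lt_of_ne' hxne) h2, h1⟩

/-- The energy of the error of a polynomial approximation `q(M)` of `M⁻¹`. -/
theorem PosDef.energy_aeval_le [Finite r] {M : Matrix n n ℂ} (hM : M.PosDef) {q : ℝ[X]} {δ : ℝ}
    (hq : ∀ x ∈ spectrum ℝ M, |1 - x * q.eval x| ≤ δ) (S : Matrix n r ℂ) :
    (M⁻¹ * S - aeval M q * S)ᴴ * M * (M⁻¹ * S - aeval M q * S) ≤ δ ^ 2 • (Sᴴ * M⁻¹ * S) := by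
  have hu : IsUnit M.det := (isUnit_iff_isUnit_det M).1 hM.isUnit
  have hsa : IsSelfAdjoint M := hM.isHermitian
  set F : Matrix n n ℂ := aeval M (1 - X * q) with hF
  have hFsa : Fᴴ = F := by
    have : IsSelfAdjoint (cfc (1 - X * q).eval M) := cfc_predicate _ _
    rw [cfc_polynomial _ _ hsa] at this
    exact this
  have hres : M⁻¹ * S - aeval M q * S = M⁻¹ * (F * S) := by
    rw [hF]
    simp only [map_sub, map_one, map_mul, aeval_X, Matrix.sub_mul, Matrix.mul_sub, Matrix.one_mul,
      Matrix.mul_assoc]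
    rw [nonsing_inv_mul_cancel_left _ _ hu]
  have hFM : F * M⁻¹ = M⁻¹ * F := by
    have hc : F * M = M * F := by
      have := (Commute.all X (1 - X * q)).map (aeval M : ℝ[X] →ₐ[ℝ] Matrix n n ℂ)
      simpa [Commute, SemiconjBy, hF] using this.symm
    calc F * M⁻¹ = M⁻¹ * (M * F) * M⁻¹ := by rw [nonsing_inv_mul_cancel_left _ _ hu]
      _ = M⁻¹ * F := by rw [← hc, ← Matrix.mul_assoc, mul_nonsing_inv_cancel_right _ _ hu]
  -- A product of commuting nonnegative elements is nonnegative; this encodes `F * M⁻¹ * F ≤ δ ^ 2 •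
  -- M⁻¹`.
  have hpos : 0 ≤ M⁻¹ * aeval M (C (δ ^ 2) - (1 - X * q) ^ 2) := by
    refine Commute.mul_nonneg hM.inv.posSemidef.nonneg ?_ ?_
    · rw [← cfc_polynomial _ _ hsa]
      refine cfc_nonneg fun x hx => ?_
      have := sq_le_sq' (abs_le.1 (hq x hx)).1 (abs_le.1 (hq x hx)).2
      simpa using this
    · rw [map_sub, aeval_C, map_pow (aeval M) (1 - X * q), ← hF]
      refine Commute.sub_right (Algebra.commutes _ _).symm (Commute.pow_right ?_ 2)
      exact hFM.symm
  have hexp : M⁻¹ * aeval M (C (δ ^ 2) - (1 - X * q) ^ 2) = δ ^ 2 • M⁻¹ - F * M⁻¹ * F := by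
    rw [map_sub, aeval_C, map_pow (aeval M) (1 - X * q), ← hF, mul_sub, hFM, Algebra.algebraMap_eq_smul_one,
      mul_smul_comm, mul_one, pow_two F, mul_assoc]
  rw [hexp] at hpos
  have := (hpos.posSemidef.conjTranspose_mul_mul_same S).nonneg
  rw [← sub_nonneg]
  convert this using 1
  rw [hres, conjTranspose_mul, conjTranspose_mul, hFsa, show M⁻¹ᴴ = M⁻¹ from hM.isHermitian.inv]
  simp only [Matrix.mul_sub, Matrix.sub_mul, Matrix.mul_smul, Matrix.smul_mul, Matrix.mul_assoc]
  rw [mul_nonsing_inv_cancel_left _ _ hu]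

end Matrix

end Galerkin

/-! ### Results and costs of composed algorithms -/

namespace MatVecAlgorithm

variable {n : ℕ} {α β : Type} (M : Matrix (Fin n) (Fin n) ℂ)

theorem result_bind (a : MatVecAlgorithm n α) (f : α → MatVecAlgorithm n β) :
    (a.bind f).result M = (f (a.result M)).result M := by
  induction a with
  | done a => rfl
  | product v next ih => exact ih _

theorem numProducts_bind (a : MatVecAlgorithm n α) (f : α → MatVecAlgorithm n β) :
    (a.bind f).numProducts M = a.numProducts M + (f (a.result M)).numProducts M := by
  induction a with
  | done a => simp [bind, numProducts, result]
  | product v next ih =>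
    simp only [bind, numProducts, result, ih]
    omega

theorem result_multiplyAll (Q : List (EuclideanSpace ℂ (Fin n))) :
    (multiplyAll Q).result M = Q.map fun q => (q, Matrix.toEuclideanLin M q) := by
  induction Q with
  | nil => rfl
  | cons q Q ih => simp [multiplyAll, result, result_bind, ih]

theorem numProducts_multiplyAll (Q : List (EuclideanSpace ℂ (Fin n))) :
    (multiplyAll Q).numProducts M = Q.length := by
  induction Q with
  | nil => rfl
  | cons q Q ih => simp [multiplyAll, numProducts, numProducts_bind, ih]

end MatVecAlgorithm

/-! ### Gram–Schmidt with deflation and the Krylov invariant -/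

namespace BlockLanczos

variable {n : ℕ}

/-- A list of pairwise orthogonal unit vectors. -/
def OrthonormalList (Q : List (EuclideanSpace ℂ (Fin n))) : Prop :=
  (∀ q ∈ Q, ‖q‖ = 1) ∧ Q.Pairwise fun x y => inner ℂ x y = 0

/-- The span of the members of a list. -/
def listSpan (Q : List (EuclideanSpace ℂ (Fin n))) : Submodule ℂ (EuclideanSpace ℂ (Fin n)) :=
  Submodule.span ℂ {v | v ∈ Q}

theorem mem_listSpan {Q : List (EuclideanSpace ℂ (Fin n))} {v : EuclideanSpace ℂ (Fin n)}
    (h : v ∈ Q) : v ∈ listSpan Q := Submodule.subset_span h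

theorem listSpan_append (Q W : List (EuclideanSpace ℂ (Fin n))) :
    listSpan (Q ++ W) = listSpan Q ⊔ listSpan W := by
  rw [listSpan, listSpan, listSpan, ← Submodule.span_union]
  congr 1
  ext v
  simp

theorem OrthonormalList.orthonormal_get {Q : List (EuclideanSpace ℂ (Fin n))}
    (h : OrthonormalList Q) : Orthonormal ℂ Q.get := by
  refine ⟨fun i => h.1 _ (List.get_mem _ _), fun i j hij => ?_⟩
  rcases lt_or_gt_of_ne hij with hlt | hlt
  · exact List.pairwise_iff_get.1 h.2 i j hlt
  · exact inner_eq_zero_symm.1 (List.pairwise_iff_get.1 h.2 j i hlt)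

theorem OrthonormalList.inner_sub_sum_eq_zero {Q : List (EuclideanSpace ℂ (Fin n))}
    (h : OrthonormalList Q) (w : EuclideanSpace ℂ (Fin n)) {v : EuclideanSpace ℂ (Fin n)}
    (hv : v ∈ Q) : inner ℂ v (w - (Q.map fun q => inner ℂ q w • q).sum) = 0 := by
  obtain ⟨i, rfl⟩ := List.get_of_mem hv
  have hsum : (Q.map fun q => inner ℂ q w • q).sum
      = ∑ j, (inner ℂ (Q.get j) w : ℂ) • Q.get j := by
    conv_lhs => rw [← List.ofFn_get Q, List.map_ofFn, List.sum_ofFn]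
    rfl
  rw [hsum, inner_sub_right, h.orthonormal_get.inner_right_fintype, sub_self]

theorem sum_inner_smul_mem_listSpan (Q : List (EuclideanSpace ℂ (Fin n)))
    (w : EuclideanSpace ℂ (Fin n)) :
    (Q.map fun q => (inner ℂ q w : ℂ) • q).sum ∈ listSpan Q := by
  refine list_sum_mem fun x hx => ?_
  obtain ⟨q, hq, rfl⟩ := List.mem_map.1 hx
  exact Submodule.smul_mem _ _ (mem_listSpan hq)

/-- Quantified over `Q` because the induction on `W` appends each new unit vector to `Q`. A dropped
vector already lies in the span of `Q`. -/
theorem orthonormalize_spec (W : List (EuclideanSpace ℂ (Fin n))) :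
    ∀ Q : List (EuclideanSpace ℂ (Fin n)), OrthonormalList Q →
      OrthonormalList (Q ++ orthonormalize Q W) ∧
      listSpan W ≤ listSpan (Q ++ orthonormalize Q W) ∧
      (orthonormalize Q W).length ≤ W.length := by
  induction W with
  | nil =>
    intro Q hQ
    refine ⟨by simpa [orthonormalize] using hQ, ?_, by simp [orthonormalize]⟩
    exact Submodule.span_le.2 fun v hv => absurd hv (by simp)
  | cons w W ih =>
    intro Q hQ
    have hcons : listSpan (w :: W) = listSpan [w] ⊔ listSpan W := listSpan_append [w] W
    have hsingle : ∀ U : Submodule ℂ (EuclideanSpace ℂ (Fin n)), w ∈ U → listSpan [w] ≤ U :=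
      fun U hU => Submodule.span_le.2 fun v hv => by
        rw [List.mem_singleton.1 hv]
        exact hU
    set u := w - (Q.map fun q => (inner ℂ q w : ℂ) • q).sum with hu
    have hw : w = u + (Q.map fun q => (inner ℂ q w : ℂ) • q).sum := by rw [hu]; abel
    by_cases h0 : u = 0
    · have he : orthonormalize Q (w :: W) = orthonormalize Q W := by
        rw [orthonormalize]
        exact if_pos h0
      rw [he]
      obtain ⟨h1, h2, h3⟩ := ih Q hQ
      refine ⟨h1, ?_, h3.trans (by simp)⟩
      rw [hcons]
      refine sup_le (hsingle _ ?_) h2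
      rw [listSpan_append]
      refine Submodule.mem_sup_left ?_
      rw [hw, h0, zero_add]
      exact sum_inner_smul_mem_listSpan Q w
    · set v := ((‖u‖⁻¹ : ℝ) : ℂ) • u with hv
      have he : orthonormalize Q (w :: W) = v :: orthonormalize (Q ++ [v]) W := by
        rw [orthonormalize]
        exact if_neg h0
      have hun : ‖u‖ ≠ 0 := norm_ne_zero_iff.2 h0
      have hQv : OrthonormalList (Q ++ [v]) := by
        refine ⟨fun q hq => ?_, ?_⟩
        · rcases List.mem_append.1 hq with hq | hq
          · exact hQ.1 q hq
          · rw [List.mem_singleton.1 hq, hv, norm_smul]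
            simp [hun]
        · refine List.pairwise_append.2 ⟨hQ.2, by simp, fun x hx y hy => ?_⟩
          rw [List.mem_singleton.1 hy, hv, inner_smul_right, hQ.inner_sub_sum_eq_zero w hx,
            mul_zero]
      obtain ⟨h1, h2, h3⟩ := ih _ hQv
      rw [he]
      rw [List.append_assoc, List.singleton_append] at h1 h2
      refine ⟨h1, ?_, by simpa using h3⟩
      rw [hcons]
      refine sup_le (hsingle _ ?_) h2
      have huv : u = (‖u‖ : ℂ) • v := by
        rw [hv, smul_smul]
        simp [hun]
      rw [hw, listSpan_append]
      refine Submodule.add_mem _ (Submodule.mem_sup_right ?_)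
        (Submodule.mem_sup_left (sum_inner_smul_mem_listSpan Q w))
      rw [huv]
      exact Submodule.smul_mem _ _ (mem_listSpan (by simp))

/-- Deflation only shortens a block, and the next block has one vector per product just made, so no
iteration costs more than the first block's length. -/
theorem iterate_numProducts_le (M : Matrix (Fin n) (Fin n) ℂ) (k : ℕ) :
    ∀ (P : List (EuclideanSpace ℂ (Fin n) × EuclideanSpace ℂ (Fin n)))
      (W : List (EuclideanSpace ℂ (Fin n))), OrthonormalList (P.map Prod.fst) →
      (iterate k P W).numProducts M ≤ k * W.length := by
  induction k with
  | zero => intro P W _; simp [iterate, MatVecAlgorithm.numProducts]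
  | succ k ih =>
    intro P W hP
    obtain ⟨h1, -, h3⟩ := orthonormalize_spec W _ hP
    simp only [iterate, MatVecAlgorithm.numProducts_bind, MatVecAlgorithm.numProducts_multiplyAll,
      MatVecAlgorithm.result_multiplyAll]
    set N := orthonormalize (P.map Prod.fst) W
    have h := ih (P ++ N.map fun q => (q, Matrix.toEuclideanLin M q))
      ((N.map fun q => (q, Matrix.toEuclideanLin M q)).map Prod.snd)
      (by simpa [Function.comp_def] using h1)
    refine (Nat.add_le_add h3 h).trans ?_
    simp only [List.length_map]
    calc W.length + k * N.length ≤ W.length + k * W.length := by gcongr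
      _ = (k + 1) * W.length := by ring

/-- The block Krylov iteration returns products with `M` of an orthonormal list whose span
contains the vectors `M ^ j x`, `j < k`, for `x` in the span of the starting data. -/
theorem iterate_result_spec (M : Matrix (Fin n) (Fin n) ℂ) (k : ℕ) :
    ∀ (P : List (EuclideanSpace ℂ (Fin n) × EuclideanSpace ℂ (Fin n)))
      (W : List (EuclideanSpace ℂ (Fin n))), OrthonormalList (P.map Prod.fst) →
      (∀ p ∈ P, p.2 = Matrix.toEuclideanLin M p.1) →
      (listSpan (P.map Prod.fst)).map (Matrix.toEuclideanLin M) ≤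
        listSpan (P.map Prod.fst) ⊔ listSpan W →
      OrthonormalList (((iterate k P W).result M).map Prod.fst) ∧
      (∀ p ∈ (iterate k P W).result M, p.2 = Matrix.toEuclideanLin M p.1) ∧
      listSpan (P.map Prod.fst) ≤ listSpan (((iterate k P W).result M).map Prod.fst) ∧
      ∀ j < k, ∀ x ∈ listSpan (P.map Prod.fst) ⊔ listSpan W,
        (Matrix.toEuclideanLin M ^ j) x ∈
          listSpan (((iterate k P W).result M).map Prod.fst) := by
  induction k with
  | zero =>
    intro P W hP hp _
    simpa [iterate, MatVecAlgorithm.result] using ⟨hP, fun a b h => hp (a, b) h⟩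
  | succ k ih =>
    intro P W hP hp hA
    obtain ⟨h1, h2, -⟩ := orthonormalize_spec W _ hP
    simp only [iterate, MatVecAlgorithm.result_bind, MatVecAlgorithm.result_multiplyAll]
    set N := orthonormalize (P.map Prod.fst) W
    set A := Matrix.toEuclideanLin M
    have hfst : (P ++ N.map fun q => (q, A q)).map Prod.fst = P.map Prod.fst ++ N := by
      simp [Function.comp_def]
    have hsnd : (N.map fun q => (q, A q)).map Prod.snd = N.map A := by
      simp [Function.comp_def]
    rw [hsnd]
    have hsup : listSpan (P.map Prod.fst) ⊔ listSpan W ≤ listSpan (P.map Prod.fst ++ N) := by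
      refine sup_le ?_ h2
      rw [listSpan_append]
      exact le_sup_left
    -- The invariant: `M` maps the span found so far into itself plus the pending block. Old vectors
    -- land in the enlarged span, new ones in the new pending block.
    have hA' : (listSpan (P.map Prod.fst ++ N)).map A ≤
        listSpan (P.map Prod.fst ++ N) ⊔ listSpan (N.map A) := by
      rw [listSpan_append, Submodule.map_sup, ← listSpan_append]
      refine sup_le ((hA.trans hsup).trans le_sup_left) (le_trans ?_ le_sup_right)
      rw [listSpan, Submodule.map_span, Submodule.span_le]
      rintro _ ⟨v, hv, rfl⟩
      exact mem_listSpan (List.mem_map_of_mem hv)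
    obtain ⟨i1, i2, i3, i4⟩ := ih (P ++ N.map fun q => (q, A q)) (N.map A)
      (by rw [hfst]; exact h1)
      (by
        intro p hpm
        rcases List.mem_append.1 hpm with h | h
        · exact hp p h
        · obtain ⟨q, -, rfl⟩ := List.mem_map.1 h
          rfl)
      (by rw [hfst]; exact hA')
    rw [hfst] at i3 i4
    refine ⟨i1, i2, (le_sup_left.trans hsup).trans i3, fun j hj x hx => ?_⟩
    cases j with
    | zero => exact i3 (hsup hx)
    | succ j =>
      rw [pow_succ]
      exact i4 j (by omega) (A x) (hA' (Submodule.mem_map_of_mem (hsup hx)))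

end BlockLanczos

/-! ### From Krylov spaces to the norm error -/

section BlockLanczosError

open Matrix Polynomial
open scoped MatrixOrder

variable {n r : ℕ}

/-- The matrix whose columns are the given vectors. -/
def colMatrix {ι : Type*} (B : ι → EuclideanSpace ℂ (Fin n)) : Matrix (Fin n) ι ℂ :=
  Matrix.of fun i a => B a i

theorem inner_eq_conjTranspose_colMatrix_mul {ι κ : Type*} (B : ι → EuclideanSpace ℂ (Fin n))
    (D : κ → EuclideanSpace ℂ (Fin n)) :
    (Matrix.of fun a i => inner ℂ (B a) (D i)) = (colMatrix B)ᴴ * colMatrix D := by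
  ext a i
  simp [colMatrix, Matrix.mul_apply, PiLp.inner_apply, mul_comm]

theorem mul_colMatrix {ι : Type*} (A : Matrix (Fin n) (Fin n) ℂ)
    (B : ι → EuclideanSpace ℂ (Fin n)) :
    A * colMatrix B = colMatrix fun i => Matrix.toEuclideanLin A (B i) := by
  ext i a
  simp [colMatrix, Matrix.mul_apply, Matrix.toLpLin_apply, Matrix.mulVec, dotProduct]

theorem colMatrix_mulVec_injective {ι : Type*} [Fintype ι] {B : ι → EuclideanSpace ℂ (Fin n)}
    (hB : LinearIndependent ℂ B) : Function.Injective (colMatrix B).mulVec := by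
  intro x y hxy
  have h := Fintype.linearIndependent_iff.1 hB (x - y) (by
    ext i
    have := congrFun hxy i
    simp only [colMatrix, Matrix.mulVec, dotProduct, Matrix.of_apply] at this
    simp only [WithLp.ofLp_sum, WithLp.ofLp_smul, Finset.sum_apply, Pi.smul_apply, Pi.sub_apply,
      smul_eq_mul, sub_mul, Finset.sum_sub_distrib, PiLp.zero_apply]
    simp only [mul_comm (x _), mul_comm (y _), this, sub_self])
  funext i
  exact sub_eq_zero.1 (h i)

theorem exists_colMatrix_mul_eq {ι κ : Type*} [Fintype κ] {B : κ → EuclideanSpace ℂ (Fin n)}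
    {D : ι → EuclideanSpace ℂ (Fin n)} (h : ∀ i, D i ∈ Submodule.span ℂ (Set.range B)) :
    ∃ V : Matrix κ ι ℂ, colMatrix D = colMatrix B * V := by
  choose c hc using fun i => (Submodule.mem_span_range_iff_exists_fun ℂ).1 (h i)
  refine ⟨Matrix.of fun a i => c i a, ?_⟩
  ext j i
  have := congrArg (fun v : EuclideanSpace ℂ (Fin n) => v j) (hc i)
  simp only [WithLp.ofLp_sum, WithLp.ofLp_smul, Finset.sum_apply, Pi.smul_apply,
    smul_eq_mul] at this
  simp [colMatrix, Matrix.mul_apply, ← this, mul_comm]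

theorem toEuclideanLin_pow (M : Matrix (Fin n) (Fin n) ℂ) (j : ℕ) :
    Matrix.toEuclideanLin (M ^ j) = Matrix.toEuclideanLin M ^ j := by
  induction j with
  | zero => ext; simp
  | succ j ih =>
    rw [pow_succ, pow_succ, ← ih]
    ext
    simp [Matrix.toLpLin_apply]

theorem toEuclideanLin_aeval_apply_mem {M : Matrix (Fin n) (Fin n) ℂ} {q : ℝ[X]} {k : ℕ}
    (hq : q.natDegree < k) {U : Submodule ℂ (EuclideanSpace ℂ (Fin n))}
    {x : EuclideanSpace ℂ (Fin n)} (hx : ∀ j < k, (Matrix.toEuclideanLin M ^ j) x ∈ U) :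
    Matrix.toEuclideanLin (aeval M q) x ∈ U := by
  rw [aeval_eq_sum_range' hq, map_sum, LinearMap.sum_apply]
  refine Submodule.sum_mem _ fun j hj => ?_
  have hsmul : q.coeff j • M ^ j = (q.coeff j : ℂ) • M ^ j := by
    ext; simp
  rw [hsmul, map_smul, LinearMap.smul_apply, toEuclideanLin_pow]
  exact Submodule.smul_mem _ _ (hx j (Finset.mem_range.1 hj))

theorem blockLanczos_numProducts_le (M : Matrix (Fin n) (Fin n) ℂ)
    (B : Fin r → EuclideanSpace ℂ (Fin n)) (k : ℕ) :
    (blockLanczos B k).numProducts M ≤ k * r := by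
  have h := BlockLanczos.iterate_numProducts_le M k [] (List.ofFn B) (by
    simp [BlockLanczos.OrthonormalList])
  simpa [blockLanczos, MatVecAlgorithm.numProducts_bind, MatVecAlgorithm.numProducts] using h

/-- The block Lanczos error is controlled by the residual on the spectrum of any polynomial
approximation of the inverse. -/
theorem norm_blockLanczos_sub_le {M : Matrix (Fin n) (Fin n) ℂ} (hM : M.PosDef)
    (B : Fin r → EuclideanSpace ℂ (Fin n)) {k : ℕ} {q : ℝ[X]} (hqk : q.natDegree < k) {δ : ℝ}
    (hq : ∀ x ∈ spectrum ℝ M, |1 - x * q.eval x| ≤ δ) :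
    ‖(blockLanczos B k).result M - (colMatrix B)ᴴ * M⁻¹ * colMatrix B‖ ≤
      δ ^ 2 * ‖(colMatrix B)ᴴ * M⁻¹ * colMatrix B‖ := by
  obtain ⟨h1, h2, -, h4⟩ := BlockLanczos.iterate_result_spec M k [] (List.ofFn B)
    (by simp [BlockLanczos.OrthonormalList]) (by simp)
    (by simp [BlockLanczos.listSpan])
  simp only [blockLanczos, MatVecAlgorithm.result_bind, MatVecAlgorithm.result]
  set P := (BlockLanczos.iterate k [] (List.ofFn B)).result M
  set Qv : Fin P.length → EuclideanSpace ℂ (Fin n) := fun a => (P.get a).1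
  have hrange : {v | v ∈ P.map Prod.fst} = Set.range Qv := by
    ext v
    constructor
    · intro hv
      obtain ⟨p, hp, rfl⟩ := List.mem_map.1 hv
      obtain ⟨i, rfl⟩ := List.get_of_mem hp
      exact ⟨i, rfl⟩
    · rintro ⟨i, rfl⟩
      exact List.mem_map_of_mem (f := Prod.fst) (List.get_mem P i)
  have hli : LinearIndependent ℂ Qv := by
    have h := h1.orthonormal_get.linearIndependent
    have hcomp := h.comp (Fin.cast (List.length_map (as := P) Prod.fst).symm)
      (Fin.cast_injective _)
    have heq : Qv = (P.map Prod.fst).get ∘ Fin.cast (List.length_map Prod.fst).symm := by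
      funext a
      simp [Qv]
    rw [heq]
    exact hcomp
  have hT : ((colMatrix Qv)ᴴ * M * colMatrix Qv).PosDef :=
    hM.conjTranspose_mul_mul_same (colMatrix_mulVec_injective hli)
  have hest : BlockLanczos.estimate B P = ((colMatrix Qv)ᴴ * colMatrix B)ᴴ *
      ((colMatrix Qv)ᴴ * M * colMatrix Qv)⁻¹ * ((colMatrix Qv)ᴴ * colMatrix B) := by
    rw [Matrix.mul_assoc (colMatrix Qv)ᴴ M, mul_colMatrix, ← inner_eq_conjTranspose_colMatrix_mul,
      ← inner_eq_conjTranspose_colMatrix_mul]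
    have : ∀ a : Fin P.length, (P.get a).2 = Matrix.toEuclideanLin M (Qv a) :=
      fun a => h2 _ (List.get_mem _ _)
    simp only [BlockLanczos.estimate, this]
    rfl
  obtain ⟨V, hV⟩ : ∃ V : Matrix (Fin P.length) (Fin r) ℂ, aeval M q * colMatrix B = colMatrix Qv * V := by
    rw [mul_colMatrix]
    refine exists_colMatrix_mul_eq fun i => ?_
    refine toEuclideanLin_aeval_apply_mem hqk fun j hj => ?_
    rw [← hrange]
    exact h4 j hj _ (Submodule.mem_sup_right (BlockLanczos.mem_listSpan (by simp)))
  have hle := hM.galerkin_error_le hT (colMatrix B) V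
  rw [← hV] at hle
  -- Nonnegativity of the error is essential: the C⋆-norm is monotone on nonnegative elements.
  have h := CStarAlgebra.norm_le_norm_of_nonneg_of_le
    (hM.galerkin_error_nonneg hT (colMatrix B)) (hle.trans (hM.energy_aeval_le hq (colMatrix B)))
  rw [hest, norm_sub_rev]
  refine h.trans ?_
  rw [norm_smul, Real.norm_of_nonneg (sq_nonneg δ)]

theorem colMatrix_single_conj_mul (s : Fin r → Fin n) (A : Matrix (Fin n) (Fin n) ℂ) :
    (colMatrix fun i => EuclideanSpace.single (s i) (1 : ℂ))ᴴ * A *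
      (colMatrix fun i => EuclideanSpace.single (s i) (1 : ℂ)) = A.submatrix s s := by
  ext i j
  simp [colMatrix, Matrix.mul_apply]

end BlockLanczosError

/-! ### Choice of the constants -/

theorem theorem2p7 :
    ∃ C : ℝ, 0 < C ∧ ∀ κ ε : ℝ, 1 ≤ κ → 0 < ε → ε ≤ 1 / 2 →
      ∃ k : ℕ, ∀ (n r : ℕ) (s : Fin r ↪ Fin n) (M : Matrix (Fin n) (Fin n) ℂ),
        M.PosDef → conditionNumber M ≤ κ →
          (((blockLanczos (fun i => EuclideanSpace.single (s i) (1 : ℂ)) k).numProducts M : ℕ) : ℝ)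
              ≤ C * (r * √κ * Real.log (1 / ε)) ∧
          ‖(blockLanczos (fun i => EuclideanSpace.single (s i) (1 : ℂ)) k).result M
              - M⁻¹.submatrix s s‖ ≤ ε * ‖M⁻¹.submatrix s s‖ := by
  refine ⟨6, by norm_num, fun κ ε hκ hε hε2 => ?_⟩
  have hsκ : 1 ≤ √κ := Real.one_le_sqrt.2 hκ
  have hL : 1 / 2 < Real.log (1 / ε) := by
    have h1 : Real.log 2 ≤ Real.log (1 / ε) :=
      Real.log_le_log (by norm_num) (by rw [le_div_iff₀ hε]; linarith)
    have := Real.log_two_gt_d9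
    linarith
  set L := Real.log (1 / ε) with hLdef
  have hLε : Real.exp (-L) = ε := by
    rw [hLdef, one_div, Real.log_inv, neg_neg, Real.exp_log hε]
  have hpos : 0 < 4 * √κ * L := by positivity
  -- The factor `4` makes `k / √(b / a) ≥ 2 * L`, as `√(b / a) ≤ 2 * √κ` below. Rounding up costs at
  -- most `1 < 2 * √κ * L`, whence the constant `6`.
  refine ⟨⌈4 * √κ * L⌉₊, fun n r s M hM hκM => ⟨?_, ?_⟩⟩
  · have h1 : (((blockLanczos (fun i => EuclideanSpace.single (s i) (1 : ℂ))
        ⌈4 * √κ * L⌉₊).numProducts M : ℕ) : ℝ) ≤ (⌈4 * √κ * L⌉₊ * r : ℕ) := by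
      exact_mod_cast blockLanczos_numProducts_le M _ _
    have h2 : (⌈4 * √κ * L⌉₊ : ℝ) ≤ 6 * (√κ * L) := by
      have := (Nat.ceil_lt_add_one hpos.le).le
      nlinarith
    refine h1.trans ?_
    push_cast
    calc (⌈4 * √κ * L⌉₊ : ℝ) * r ≤ 6 * (√κ * L) * r := by gcongr
      _ = 6 * (r * √κ * L) := by ring
  -- For `n = 0` the norms of `M` and `M⁻¹` vanish, so no interval with `a > 0` is available.
  · rcases isEmpty_or_nonempty (Fin n) with hn | hn
    · have : IsEmpty (Fin r) := Function.isEmpty s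
      rw [Subsingleton.elim (M⁻¹.submatrix s s) 0, norm_zero, mul_zero, sub_zero,
        Subsingleton.elim ((blockLanczos _ _).result M) 0, norm_zero]
    set k := ⌈4 * √κ * L⌉₊
    have hk : 0 < k := Nat.ceil_pos.2 hpos
    have hkle : 4 * √κ * L ≤ k := Nat.le_ceil _
    have hM0 : 0 < ‖M‖ := norm_pos_iff.2 hM.isUnit.ne_zero
    have hMi0 : 0 < ‖M⁻¹‖ := norm_pos_iff.2 hM.inv.isUnit.ne_zero
    have hone : 1 ≤ ‖M‖ * ‖M⁻¹‖ := by
      have h := norm_mul_le M M⁻¹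
      rwa [Matrix.mul_nonsing_inv _ ((Matrix.isUnit_iff_isUnit_det M).1 hM.isUnit),
        norm_one] at h
    have ha : 0 < ‖M⁻¹‖⁻¹ := inv_pos.2 hMi0
    -- Doubling the right endpoint keeps the interval nondegenerate when `‖M‖ * ‖M⁻¹‖ = 1`.
    have hab : ‖M⁻¹‖⁻¹ < 2 * ‖M‖ := by
      rw [inv_lt_iff_one_lt_mul₀ hMi0]
      linarith
    obtain ⟨q, hqk, hq⟩ := exists_polynomial_abs_one_sub_mul_le ha hab hk
    have h := norm_blockLanczos_sub_le hM (fun i => EuclideanSpace.single (s i) (1 : ℂ)) hqk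
      (fun x hx => hq x ⟨(hM.spectrum_subset_Icc hx).1,
        (hM.spectrum_subset_Icc hx).2.trans (by linarith)⟩)
    rw [colMatrix_single_conj_mul] at h
    refine h.trans (mul_le_mul_of_nonneg_right ?_ (norm_nonneg _))
    have hs : √(2 * ‖M‖ / ‖M⁻¹‖⁻¹) ≤ 2 * √κ := by
      rw [show (2 : ℝ) * √κ = √(4 * κ) by
        rw [Real.sqrt_mul (by norm_num), show (4 : ℝ) = 2 ^ 2 by norm_num,
          Real.sqrt_sq (by norm_num)]]
      apply Real.sqrt_le_sqrt
      rw [div_inv_eq_mul]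
      have : ‖M‖ * ‖M⁻¹‖ ≤ κ := hκM
      nlinarith
    have hs0 : 0 < √(2 * ‖M‖ / ‖M⁻¹‖⁻¹) := Real.sqrt_pos.2 (by positivity)
    have hexp : Real.exp (-(k / √(2 * ‖M‖ / ‖M⁻¹‖⁻¹))) ≤ ε ^ 2 := by
      rw [← hLε, ← Real.exp_nat_mul]
      apply Real.exp_le_exp.2
      have : 2 * L ≤ k / √(2 * ‖M‖ / ‖M⁻¹‖⁻¹) := by
        rw [le_div_iff₀ hs0]
        nlinarith
      push_cast
      linarith
    calc (2 * Real.exp (-(k / √(2 * ‖M‖ / ‖M⁻¹‖⁻¹)))) ^ 2 ≤ (2 * ε ^ 2) ^ 2 := by gcongr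
      _ = ε * (4 * ε ^ 3) := by ring
      _ ≤ ε * (4 * (1 / 2) ^ 3) := by gcongr
      _ ≤ ε := by linarith
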